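/- Let $d\ge 1$ and $n\ge 0$ be integers, and write $[n]=\{1,\dots,n\}$. A \emph{state} is a positive semidefinite operator of unit trace. Let $Q$ be a state on $\mathbb{C}^d$ that is proportional to a projector (a self-adjoint idempotent), and let $(|q_i\rangle)_{i=1}^d$ be an orthonormal basis of $\mathbb{C}^d$ such that $Q=\sum_{i=1}^d\lambda_i\,|q_i\rangle\langle q_i|$ with $\lambda_1\ge\dots\ge\lambda_d$ the eigenvalues of $Q$ in non-increasing order. For $I\subseteq[n]$ put $I^c=[n]\setminus I$, and for an operator $A$ on $\mathbb{C}^d$ let $A^{\otimes I}$ be the operator on $(\mathbb{C}^d)^{\otimes I}$ all of whose tensor factors equal $A$; an operator on $(\mathbb{C}^d)^{\otimes I}$ tensored with one on $(\mathbb{C}^d)^{\otimes I^c}$ is regarded as an operator on $(\mathbb{C}^d)^{\otimes n}$ acting on the corresponding factors. For self-adjoint operators $B,C$ on the same $N$-dimensional space, with eigenvalues (with multiplicity) listed in non-increasing order as $\lambda_i(B)$ and $\lambda_i(C)$, write $B\succeq C$ ($B$ majorizes $C$) if $\sum_{i=1}^k\lambda_i(B)\ge\sum_{i=1}^k\lambda_i(C)$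 for all $1\le k\le N-1$, and $\sum_{i=1}^N\lambda_i(B)=\sum_{i=1}^N\lambda_i(C)$. (i) For all $t\in[0,1]$, all $I_1,I_2\subseteq[n]$, and all unit vectors $|\psi_1\rangle\in(\mathbb{C}^d)^{\otimes I_1}$ and $|\psi_2\rangle\in(\mathbb{C}^d)^{\otimes I_2}$, $$(1-t)\,|q_1\rangle\langle q_1|^{\otimes I_1}\otimes Q^{\otimes I_1^c}+t\,|q_1\rangle\langle q_1|^{\otimes I_2}\otimes Q^{\otimes I_2^c}\;\succeq\;(1-t)\,|\psi_1\rangle\langle\psi_1|_{I_1}\otimes Q^{\otimes I_1^c}+t\,|\psi_2\rangle\langle\psi_2|_{I_2}\otimes Q^{\otimes I_2^c}.$$ (ii) The strong spin alignment conjecture holds for such $Q$ whenever the measure has support of size at most two: for every probability measure $\mu$ on the set of subsets of $[n]$ with $|\mathrm{supp}(\mu)|\le 2$ and every tuple $(\rho_I)_{I\subseteq[n]}$ of states $\rho_I$ on $(\mathbb{C}^d)^{\otimes I}$, $$\sum_{I\subseteq[n]}\mu_I\,|q_1\rangle\langle q_1|^{\otimes I}\otimes Q^{\otimes I^c}\;\succeq\;\sum_{I\subseteq[n]}\mu_I\,\rho_I\otimes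 Q^{\otimes I^c}.$$ -/

import Mathlib

open scoped ComplexOrder

/-! ### Majorization -/

/-- `x` with its entries rearranged in non-increasing order. -/
noncomputable def decreasingRearrangement {N : ℕ} (x : Fin N → ℝ) : Fin N → ℝ :=
  x ∘ Tuple.sort (fun i => -x i)

/-- `x ⪰ y` for real vectors: every partial sum of the `k` largest entries of `x` is at least
the corresponding one for `y`, and the total sums agree. -/
def VecMajorizes {N : ℕ} (x y : Fin N → ℝ) : Prop :=
  (∀ k : ℕ, k < N →
    ∑ i : Fin N with i.val < k, decreasingRearrangement y i ≤
      ∑ i : Fin N with i.val < k, decreasingRearrangement x i) ∧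
  ∑ i, x i = ∑ i, y i

/-- `B ⪰ C` for operators: both are self-adjoint, and the vector of eigenvalues of `B`
(counted with multiplicity) majorizes that of `C`. -/
def OpMajorizes {ι : Type*} [Fintype ι] [DecidableEq ι] (B C : Matrix ι ι ℂ) : Prop :=
  ∃ (hB : B.IsHermitian) (hC : C.IsHermitian), VecMajorizes hB.eigenvalues₀ hC.eigenvalues₀

/-! ### States -/

/-- A state: a positive semidefinite operator of unit trace. -/
structure IsState {ι : Type*} [Fintype ι] (ρ : Matrix ι ι ℂ) : Prop where
  posSemidef : ρ.PosSemidef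
  trace_eq_one : ρ.trace = 1

/-- The rank-one operator `|ψ⟩⟨ψ|`. -/
noncomputable def ketbra {ι : Type*} (ψ : EuclideanSpace ℂ ι) : Matrix ι ι ℂ :=
  Matrix.vecMulVec ψ.ofLp (star ψ.ofLp)

/-! ### Operators on `n` qudits

For `J ⊆ [n]`, operators on the tensor factors in `J` are matrices in the product basis of
`(ℂ^d)^{⊗ J}`, which is indexed by the functions `J → Fin d`. -/

/-- `A^{⊗ J}`: the factor at every site of `J` is `A`. -/
def tensorPow {d n : ℕ} (J : Finset (Fin n)) (A : Matrix (Fin d) (Fin d) ℂ) :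
    Matrix (J → Fin d) (J → Fin d) ℂ :=
  Matrix.of fun x y => ∏ j, A (x j) (y j)

/-- `A_I ⊗ B_{Iᶜ}`, where `A` acts on the factors in `I` and `B` on the remaining ones. -/
def tensorCompl {d n : ℕ} (I : Finset (Fin n))
    (A : Matrix (I → Fin d) (I → Fin d) ℂ)
    (B : Matrix ((Iᶜ : Finset (Fin n)) → Fin d) ((Iᶜ : Finset (Fin n)) → Fin d) ℂ) :
    Matrix (Fin n → Fin d) (Fin n → Fin d) ℂ :=
  Matrix.of fun x y =>
    A (fun i => x i) (fun i => y i) * B (fun i => x i) (fun i => y i)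

/-- The alignment operator `∑_{I ⊆ [n]} μ_I ρ_I ⊗ Q^{⊗ Iᶜ}` of the tuple `ρ`. -/
noncomputable def alignmentOperator {d n : ℕ} (μ : Finset (Fin n) → ℝ)
    (Q : Matrix (Fin d) (Fin d) ℂ)
    (ρ : (I : Finset (Fin n)) → Matrix (I → Fin d) (I → Fin d) ℂ) :
    Matrix (Fin n → Fin d) (Fin n → Fin d) ℂ :=
  ∑ I : Finset (Fin n), μ I • tensorCompl I (ρ I) (tensorPow Iᶜ Q)

/-!
Write `Q` as a multiple of a projector. Conjugating by the same unitary on every site turns it into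
a multiple of the coordinate projector on the labels in a set `S`, and `q₀` into the first basis
vector; the ambient factors `Q^{⊗ Iᶜ}` then become multiples of coordinate projectors. Hence for
pure states both sides are combinations `a P + b R` of two orthogonal projectors with `a, b ≥ 0`.
The aligned projectors commute: they are the coordinate projectors onto two sets of labels `D₁`,
`D₂` (`alignedSet`), and the projectors `P`, `R` on the other side have the same ranks.

The heart of the proof is the bound `∑ⱼ ⟪zⱼ, (P + R) zⱼ⟫ ≤ k + |D₁ ∩ D₂|` for `k` orthonormal
vectors `zⱼ` (`LinearMap.IsSymmetricProjection.sum_re_inner_add_le`). The eigenvalues of `P + R`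
above `1` are `1 + cos θ`, with `θ` the principal angles between the ranges, so the bound says that
the sum of the cosines, that is, the trace norm of `P R`, is at most `|D₁ ∩ D₂|`. It is proved by
passing to the Gram operator `[[P, PR], [RP, R]]`, whose nonzero spectrum is that of `P + R`, and
by applying Bessel's inequality there to an explicit decomposition of `P R` into rank-one operators
(`tensorCompl_ketbra_mul`). The decomposition contracts `ψ` and `φ` over the sites in `I ∩ J`, and
the squared norms of its vectors sum to at most `|D₁ ∩ D₂|` because `ψ` and `φ` are unit vectors
(`sum_norm_crossVec_sq_le`).

Assume `b ≤ a`. Writing `a P + b R = (a - b) P + b (P + R)` and using the trivial bounds by ranks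
and by `k`, the sum of `k` values of the quadratic form of `a P + b R` is at most the total weight
of a `k`-element set of labels nested in the chain `D₁ ∩ D₂ ⊆ D₁ ⊆ D₁ ∪ D₂`
(`Finset.exists_card_eq_le_mul_card_inter`). By Ky Fan's principle (`opMajorizes_iff`) this is the
majorization for pure states. Mixed states follow since the operators majorized by a fixed one form
a convex set (`OpMajorizes.sum_smul`).
-/

open scoped InnerProductSpace

/-! ### Sums of quadratic forms of two projections over orthonormal systems -/

section InnerProductSpace

variable {E κ : Type*} [NormedAddCommGroup E] [InnerProductSpace ℂ E]

/-- Bessel's inequality in `E × E`, applied to the vector `(e, f)`. The difference of the squared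
inner products with `(e, f)` and `(e, -f)` isolates the mixed terms on the left. -/
theorem Orthonormal.four_mul_sum_re_inner_mul_inner_le {v : κ → WithLp 2 (E × E)}
    (hv : Orthonormal ℂ v) (s : Finset κ) (e f : E) :
    4 * ∑ i ∈ s, (⟪(v i).fst, e⟫_ℂ * ⟪f, (v i).snd⟫_ℂ).re ≤ ‖e‖ ^ 2 + ‖f‖ ^ 2 := by
  have hbessel := hv.sum_inner_products_le (s := s) (WithLp.toLp 2 (e, f))
  have hnorm : ‖(WithLp.toLp 2 (e, f) : WithLp 2 (E × E))‖ ^ 2 = ‖e‖ ^ 2 + ‖f‖ ^ 2 := by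
    simp [WithLp.prod_norm_sq_eq_of_L2]
  rw [hnorm] at hbessel
  refine le_trans ?_ hbessel
  rw [Finset.mul_sum]
  refine Finset.sum_le_sum fun i _ => ?_
  rw [WithLp.prod_inner_apply]
  change _ ≤ ‖⟪(v i).fst, e⟫_ℂ + ⟪(v i).snd, f⟫_ℂ‖ ^ 2
  rw [← inner_conj_symm f (v i).snd]
  generalize ⟪(v i).fst, e⟫_ℂ = p
  generalize ⟪(v i).snd, f⟫_ℂ = r
  rw [← Complex.normSq_eq_norm_sq, Complex.normSq_apply]
  simp only [Complex.mul_re, Complex.add_re, Complex.add_im, Complex.conj_re, Complex.conj_im]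
  nlinarith [sq_nonneg (p.re - r.re), sq_nonneg (p.im - r.im)]

theorem OrthonormalBasis.re_inner_map_self_eq_sum {ι : Type*} [Fintype ι]
    (b : OrthonormalBasis ι ℂ E) {S : E →ₗ[ℂ] E} {l : ι → ℝ}
    (hS : ∀ i, S (b i) = (l i : ℂ) • b i) (z : E) :
    (⟪z, S z⟫_ℂ).re = ∑ i, l i * ‖⟪b i, z⟫_ℂ‖ ^ 2 := by
  have h : S z = ∑ i, (⟪b i, z⟫_ℂ * l i) • b i := by
    conv_lhs => rw [← b.sum_repr' z]
    rw [map_sum]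
    exact Finset.sum_congr rfl fun i _ => by rw [map_smul, hS, smul_smul]
  rw [h, inner_sum, Complex.re_sum]
  refine Finset.sum_congr rfl fun i _ => ?_
  rw [inner_smul_right, ← inner_conj_symm z (b i)]
  generalize ⟪b i, z⟫_ℂ = p
  rw [← Complex.normSq_eq_norm_sq, Complex.normSq_apply]
  simp
  ring

theorem Orthonormal.sum_norm_inner_sq_le_one {z : κ → E} (hz : Orthonormal ℂ z) (s : Finset κ)
    {x : E} (hx : ‖x‖ = 1) : ∑ j ∈ s, ‖⟪x, z j⟫_ℂ‖ ^ 2 ≤ 1 := by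
  simpa [hx, norm_inner_symm x] using hz.sum_inner_products_le (s := s) x

/-- The quadratic form of a diagonalizable `S`, summed over orthonormal vectors, is at most the
trace of the positive part of `S`. -/
theorem Orthonormal.sum_re_inner_map_self_le_sum_filter_pos {ι : Type*} [Fintype ι]
    (b : OrthonormalBasis ι ℂ E) {S : E →ₗ[ℂ] E} {l : ι → ℝ}
    (hS : ∀ i, S (b i) = (l i : ℂ) • b i) {z : κ → E} (hz : Orthonormal ℂ z) (s : Finset κ) :
    ∑ j ∈ s, (⟪z j, S (z j)⟫_ℂ).re ≤ ∑ i with 0 < l i, l i := by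
  simp_rw [b.re_inner_map_self_eq_sum hS]
  rw [Finset.sum_comm, Finset.sum_filter]
  refine Finset.sum_le_sum fun i _ => ?_
  rw [← Finset.mul_sum]
  have h1 := hz.sum_norm_inner_sq_le_one s (b.orthonormal.1 i)
  have h0 : 0 ≤ ∑ j ∈ s, ‖⟪b i, z j⟫_ℂ‖ ^ 2 := Finset.sum_nonneg fun _ _ => by positivity
  split_ifs with h
  · nlinarith
  · nlinarith

namespace LinearMap.IsSymmetricProjection

variable {P R : E →ₗ[ℂ] E}

theorem apply_apply (hP : P.IsSymmetricProjection) (x : E) : P (P x) = P x :=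
  LinearMap.congr_fun hP.isIdempotentElem x

theorem inner_map_map (hP : P.IsSymmetricProjection) (x y : E) :
    ⟪P x, P y⟫_ℂ = ⟪x, P y⟫_ℂ := by
  rw [hP.isSymmetric x (P y), hP.apply_apply]

theorem re_inner_map_self_le (hP : P.IsSymmetricProjection) (x : E) :
    (⟪x, P x⟫_ℂ).re ≤ ‖x‖ ^ 2 := by
  have h1 : (⟪x, P x⟫_ℂ).re = ‖P x‖ ^ 2 := by
    rw [← hP.inner_map_map, inner_self_eq_norm_sq_to_K]
    norm_cast
  have h2 : (⟪x, P x⟫_ℂ).re ≤ ‖x‖ * ‖P x‖ := re_inner_le_norm (𝕜 := ℂ) x (P x)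
  nlinarith [sq_nonneg (‖x‖ - ‖P x‖), norm_nonneg x, norm_nonneg (P x)]

theorem re_inner_map_self_nonneg (hP : P.IsSymmetricProjection) (x : E) :
    0 ≤ (⟪x, P x⟫_ℂ).re := by
  rw [← hP.inner_map_map]
  exact inner_self_nonneg (𝕜 := ℂ)

/-- If `PR = ∑ₐ |eₐ⟩⟨fₐ|` for orthogonal projections `P` and `R`, then the part of `P + R` above `1`
has trace at most `∑ₐ (‖eₐ‖² + ‖fₐ‖²) / 2`. -/
theorem sum_eigenvalues_sub_one_le (hP : P.IsSymmetricProjection)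
    (hR : R.IsSymmetricProjection) {α : Type*} (A : Finset α) (e f : α → E)
    (hPR : ∀ x, P (R x) = ∑ a ∈ A, ⟪f a, x⟫_ℂ • e a)
    {ι : Type*} {x : ι → E} (hx : Orthonormal ℂ x) {l : ι → ℝ}
    (hS : ∀ i, P (x i) + R (x i) = (l i : ℂ) • x i) (s : Finset ι) (hs : ∀ i ∈ s, 0 < l i) :
    ∑ i ∈ s, (l i - 1) ≤ (1 / 2) * ∑ a ∈ A, (‖e a‖ ^ 2 + ‖f a‖ ^ 2) := by
  classical
  -- `v i` is the image of `x i` under `x ↦ (P x, R x)`, normalized: an eigenvector of the Gram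
  -- operator `[[P, PR], [RP, R]]`, which has the same nonzero eigenvalues as `P + R`.
  let v : s → WithLp 2 (E × E) := fun i =>
    ((Real.sqrt (l i))⁻¹ : ℂ) • WithLp.toLp 2 (P (x i), R (x i))
  have hsq : ∀ i : s, (Real.sqrt (l i)) * (Real.sqrt (l i)) = l i := fun i =>
    Real.mul_self_sqrt (hs i i.2).le
  have hsqC : ∀ i : s, ((Real.sqrt (l i) : ℝ) : ℂ) * (Real.sqrt (l i) : ℝ) = (l i : ℂ) :=
    fun i => by rw [← Complex.ofReal_mul, hsq]
  have hpos : ∀ i : s, 0 < Real.sqrt (l i) := fun i => Real.sqrt_pos.2 (hs i i.2)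
  have hinner : ∀ i j, ⟪P (x i), P (x j)⟫_ℂ + ⟪R (x i), R (x j)⟫_ℂ = l j * ⟪x i, x j⟫_ℂ := by
    intro i j
    rw [hP.inner_map_map, hR.inner_map_map, ← inner_add_right, hS, inner_smul_right]
  have hv : Orthonormal ℂ v := by
    rw [orthonormal_iff_ite]
    intro i j
    simp only [v]
    rw [inner_smul_left, inner_smul_right, WithLp.prod_inner_apply]
    change _ * (_ * (⟪P (x i), P (x j)⟫_ℂ + ⟪R (x i), R (x j)⟫_ℂ)) = _
    rw [hinner, orthonormal_iff_ite.1 hx]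
    by_cases hij : i = j
    · subst hij
      have h1 : ((Real.sqrt (l i) : ℝ) : ℂ) ≠ 0 := by exact_mod_cast (hpos i).ne'
      rw [if_pos rfl, if_pos rfl, ← hsqC i]
      simp only [map_inv₀, Complex.conj_ofReal]
      field_simp
    · have : (i : ι) ≠ j := fun h => hij (Subtype.ext h)
      simp [hij, this]
  have hval : ∀ i : s, l i - 1 =
      2 * ∑ a ∈ A, (⟪(v i).fst, e a⟫_ℂ * ⟪f a, (v i).snd⟫_ℂ).re := by
    intro i
    have hl := hs i i.2
    -- Comparing `‖(P + R) x‖²` computed in two ways gives `l² = l + 2 Re ⟪P x, R x⟫`.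
    have h1 : l i * l i = l i + 2 * (⟪P (x i), R (x i)⟫_ℂ).re := by
      have hn : ⟪P (x i) + R (x i), P (x i) + R (x i)⟫_ℂ = (l i * l i : ℂ) := by
        rw [hS, inner_smul_left, inner_smul_right, orthonormal_iff_ite.1 hx]
        simp
      have hd := hinner i i
      rw [orthonormal_iff_ite.1 hx, if_pos rfl, mul_one] at hd
      rw [inner_add_left, inner_add_right, inner_add_right] at hn
      have hc : (⟪R (x i), P (x i)⟫_ℂ).re = (⟪P (x i), R (x i)⟫_ℂ).re := by
        rw [← inner_conj_symm, Complex.conj_re]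
      have hn' := congrArg Complex.re hn
      have hd' := congrArg Complex.re hd
      simp only [Complex.add_re, Complex.mul_re, Complex.ofReal_re, Complex.ofReal_im] at hn' hd'
      linarith
    have h2 : ⟪P (x i), R (x i)⟫_ℂ = ∑ a ∈ A, ⟪P (x i), e a⟫_ℂ * ⟪f a, R (x i)⟫_ℂ := by
      have : ⟪P (x i), R (x i)⟫_ℂ = ⟪P (x i), P (R (R (x i)))⟫_ℂ := by
        rw [hR.apply_apply, ← hP.isSymmetric, hP.apply_apply]
      rw [this, hPR, inner_sum]
      simp only [inner_smul_right, mul_comm]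
    have h3 : ∀ a, (⟪(v i).fst, e a⟫_ℂ * ⟪f a, (v i).snd⟫_ℂ).re =
        (l i)⁻¹ * (⟪P (x i), e a⟫_ℂ * ⟪f a, R (x i)⟫_ℂ).re := by
      intro a
      have e1 : (v i).fst = ((Real.sqrt (l i))⁻¹ : ℂ) • P (x i) := rfl
      have e2 : (v i).snd = ((Real.sqrt (l i))⁻¹ : ℂ) • R (x i) := rfl
      rw [e1, e2, inner_smul_left, inner_smul_right, ← Complex.re_ofReal_mul]
      congr 1
      rw [Complex.ofReal_inv, ← hsqC i]
      simp only [map_inv₀, Complex.conj_ofReal, mul_inv]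
      ring
    simp_rw [h3]
    rw [← Finset.mul_sum, ← Complex.re_sum, ← h2]
    field_simp
    linarith
  calc ∑ i ∈ s, (l i - 1) = ∑ i : s, (l i - 1) := (Finset.sum_coe_sort s fun i => l i - 1).symm
    _ = ∑ a ∈ A, 2 * ∑ i : s, (⟪(v i).fst, e a⟫_ℂ * ⟪f a, (v i).snd⟫_ℂ).re := by
      simp_rw [hval, Finset.mul_sum]
      rw [Finset.sum_comm]
    _ ≤ ∑ a ∈ A, (1 / 2) * (‖e a‖ ^ 2 + ‖f a‖ ^ 2) := by
      refine Finset.sum_le_sum fun a _ => ?_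
      have := hv.four_mul_sum_re_inner_mul_inner_le Finset.univ (e a) (f a)
      linarith
    _ = _ := by rw [Finset.mul_sum]

/-- `∑ⱼ ⟪zⱼ, (P + R) zⱼ⟫` exceeds the number of vectors by at most the bound on the trace norm of
`PR` that the decomposition into rank-one operators provides. -/
theorem sum_re_inner_add_le [FiniteDimensional ℂ E] (hP : P.IsSymmetricProjection)
    (hR : R.IsSymmetricProjection) {α : Type*} (A : Finset α) (e f : α → E)
    (hPR : ∀ x, P (R x) = ∑ a ∈ A, ⟪f a, x⟫_ℂ • e a)
    {z : κ → E} (hz : Orthonormal ℂ z) (s : Finset κ) :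
    ∑ j ∈ s, ((⟪z j, P (z j)⟫_ℂ).re + (⟪z j, R (z j)⟫_ℂ).re) ≤
      s.card + (1 / 2) * ∑ a ∈ A, (‖e a‖ ^ 2 + ‖f a‖ ^ 2) := by
  have hsymm : (P + R).IsSymmetric := hP.isSymmetric.add hR.isSymmetric
  let x := hsymm.eigenvectorBasis rfl
  let l := hsymm.eigenvalues rfl
  have hS : ∀ i, P (x i) + R (x i) = (l i : ℂ) • x i := fun i =>
    hsymm.apply_eigenvectorBasis rfl i
  have hS' : ∀ i, (P + R - LinearMap.id : E →ₗ[ℂ] E) (x i) = ((l i - 1 : ℝ) : ℂ) • x i := by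
    intro i
    simp [hS, sub_smul]
  have h1 := hz.sum_re_inner_map_self_le_sum_filter_pos x hS' s
  have h2 := hP.sum_eigenvalues_sub_one_le hR A e f hPR x.orthonormal hS
    (Finset.univ.filter fun i => 0 < l i - 1) (by
      intro i hi
      have := (Finset.mem_filter.1 hi).2
      linarith)
  have h3 : ∑ j ∈ s, (⟪z j, (P + R - LinearMap.id : E →ₗ[ℂ] E) (z j)⟫_ℂ).re =
      ∑ j ∈ s, ((⟪z j, P (z j)⟫_ℂ).re + (⟪z j, R (z j)⟫_ℂ).re) - s.card := by
    have : ∀ j, (⟪z j, (P + R - LinearMap.id : E →ₗ[ℂ] E) (z j)⟫_ℂ).re =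
        ((⟪z j, P (z j)⟫_ℂ).re + (⟪z j, R (z j)⟫_ℂ).re) - 1 := by
      intro j
      rw [LinearMap.sub_apply, LinearMap.add_apply, inner_sub_right, inner_add_right]
      simp [hz.1 j]
    simp_rw [this]
    rw [Finset.sum_sub_distrib]
    simp
  linarith

end LinearMap.IsSymmetricProjection

end InnerProductSpace

/-! ### Majorization and Ky Fan's principle -/

section Majorization

theorem Antitone.decreasingRearrangement_eq {N : ℕ} {x : Fin N → ℝ} (hx : Antitone x) :
    decreasingRearrangement x = x := by
  have h : Monotone fun i => -x i := fun i j hij => neg_le_neg (hx hij)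
  rw [decreasingRearrangement, Tuple.sort_eq_refl_iff_monotone.2 h]
  rfl

theorem Antitone.sum_mul_le_sum_filter_lt {N : ℕ} {l : Fin N → ℝ} (hl : Antitone l) {k : ℕ}
    (hk : k < N) {w : Fin N → ℝ} (h0 : ∀ i, 0 ≤ w i) (h1 : ∀ i, w i ≤ 1)
    (hw : ∑ i, w i = k) : ∑ i, l i * w i ≤ ∑ i with i.val < k, l i := by
  -- It suffices to compare after subtracting the threshold `l k` from every value.
  have key : ∀ i, (l i - l ⟨k, hk⟩) * (w i - if i.val < k then 1 else 0) ≤ 0 := by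
    intro i
    split_ifs with h
    · have : l ⟨k, hk⟩ ≤ l i := hl (Fin.le_def.2 h.le)
      nlinarith [h1 i]
    · have : l i ≤ l ⟨k, hk⟩ := hl (Fin.le_def.2 (not_lt.1 h))
      nlinarith [h0 i]
  have hsum := Finset.sum_nonpos fun i (_ : i ∈ Finset.univ) => key i
  have hcard : ∑ i : Fin N, (if i.val < k then (1 : ℝ) else 0) = k := by
    rw [Finset.sum_boole, Fin.card_filter_val_lt, min_eq_right hk.le]
  have hexp : ∑ i, (l i - l ⟨k, hk⟩) * (w i - if i.val < k then 1 else 0) =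
      ∑ i, l i * w i - ∑ i with i.val < k, l i := by
    rw [Finset.sum_filter]
    have : ∀ i, (l i - l ⟨k, hk⟩) * (w i - if i.val < k then 1 else 0) =
        l i * w i - (if i.val < k then l i else 0)
          - (l ⟨k, hk⟩ * w i - l ⟨k, hk⟩ * if i.val < k then 1 else 0) := by
      intro i
      split_ifs <;> ring
    simp_rw [this, Finset.sum_sub_distrib, ← Finset.mul_sum, hw, hcard]
    ring
  linarith

/-- Ky Fan's inequality. -/
theorem Orthonormal.sum_re_inner_map_self_le_sum_filter_lt {E κ : Type*} [NormedAddCommGroup E]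
    [InnerProductSpace ℂ E] {N : ℕ} (b : OrthonormalBasis (Fin N) ℂ E) {S : E →ₗ[ℂ] E}
    {l : Fin N → ℝ} (hl : Antitone l) (hS : ∀ i, S (b i) = (l i : ℂ) • b i) {z : κ → E}
    (hz : Orthonormal ℂ z) {s : Finset κ} (hs : s.card < N) :
    ∑ j ∈ s, (⟪z j, S (z j)⟫_ℂ).re ≤ ∑ i with i.val < s.card, l i := by
  simp_rw [b.re_inner_map_self_eq_sum hS]
  rw [Finset.sum_comm]
  simp_rw [← Finset.mul_sum]
  refine hl.sum_mul_le_sum_filter_lt hs (fun i => Finset.sum_nonneg fun _ _ => by positivity)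
    (fun i => hz.sum_norm_inner_sq_le_one s (b.orthonormal.1 i)) ?_
  rw [Finset.sum_comm]
  have : ∀ j, ∑ i, ‖⟪b i, z j⟫_ℂ‖ ^ 2 = 1 := fun j => by
    rw [b.sum_sq_norm_inner_right, hz.1 j, one_pow]
  simp [this]

variable {ι : Type*} [Fintype ι] [DecidableEq ι]

theorem Matrix.IsHermitian.sum_eigenvalues₀ {B : Matrix ι ι ℂ} (hB : B.IsHermitian) :
    ∑ i, hB.eigenvalues₀ i = B.trace.re := by
  rw [hB.trace_eq_sum_eigenvalues, Complex.re_sum]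
  refine Fintype.sum_equiv (Fintype.equivOfCardEq (Fintype.card_fin _)) _ _ fun i => ?_
  simp [Matrix.IsHermitian.eigenvalues]

/-- Ky Fan's principle: `B` majorizes `C` if and only if their traces agree and, for
every `k`, the quadratic form of `C` summed over `k` orthonormal vectors never exceeds the sum of
the `k` largest eigenvalues of `B`. -/
theorem opMajorizes_iff {B C : Matrix ι ι ℂ} (hB : B.IsHermitian) (hC : C.IsHermitian) :
    OpMajorizes B C ↔ B.trace = C.trace ∧
      ∀ (z : OrthonormalBasis ι ℂ (EuclideanSpace ℂ ι)) (s : Finset ι),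
        s.card < Fintype.card ι →
        ∑ j ∈ s, (⟪z j, C.toEuclideanLin (z j)⟫_ℂ).re ≤
          ∑ i with i.val < s.card, hB.eigenvalues₀ i := by
  have htr : B.trace = C.trace ↔ ∑ i, hB.eigenvalues₀ i = ∑ i, hC.eigenvalues₀ i := by
    rw [hB.sum_eigenvalues₀, hC.sum_eigenvalues₀]
    refine ⟨fun h => by rw [h], fun h => Complex.ext h ?_⟩
    rw [hB.trace_eq_sum_eigenvalues, hC.trace_eq_sum_eigenvalues]
    simp
  let b := (Matrix.isSymmetric_toEuclideanLin_iff.mpr hC).eigenvectorBasis finrank_euclideanSpace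
  have hb : ∀ i, C.toEuclideanLin (b i) = (hC.eigenvalues₀ i : ℂ) • b i := fun i =>
    (Matrix.isSymmetric_toEuclideanLin_iff.mpr hC).apply_eigenvectorBasis finrank_euclideanSpace i
  constructor
  · rintro ⟨_, _, hle, hsum⟩
    refine ⟨htr.2 hsum, fun z s hs => ?_⟩
    have := hle s.card hs
    rw [hB.eigenvalues₀_antitone.decreasingRearrangement_eq,
      hC.eigenvalues₀_antitone.decreasingRearrangement_eq] at this
    exact (z.orthonormal.sum_re_inner_map_self_le_sum_filter_lt b hC.eigenvalues₀_antitone hb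
      hs).trans this
  · rintro ⟨h, hle⟩
    refine ⟨hB, hC, fun k hk => ?_, htr.1 h⟩
    rw [hB.eigenvalues₀_antitone.decreasingRearrangement_eq,
      hC.eigenvalues₀_antitone.decreasingRearrangement_eq]
    let e : Fin (Fintype.card ι) ≃ ι := Fintype.equivOfCardEq (Fintype.card_fin _)
    let s : Finset ι := (Finset.univ.filter fun i : Fin (Fintype.card ι) => i.val < k).map
      e.toEmbedding
    have hs : s.card = k := by
      rw [Finset.card_map, Fin.card_filter_val_lt, min_eq_right hk.le]
    have := hle (b.reindex e) s (by rw [hs]; exact hk)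
    rw [hs, Finset.sum_map] at this
    refine le_trans (le_of_eq (Finset.sum_congr rfl fun i _ => ?_)) this
    simp [hb, b.orthonormal.1 i]

/-- To bound the partial sums of the eigenvalues of `B` from below, it suffices to evaluate its
quadratic form on members of some orthonormal basis `b`. -/
theorem opMajorizes_of_forall_exists {B C : Matrix ι ι ℂ} (hB : B.IsHermitian)
    (hC : C.IsHermitian) (htr : B.trace = C.trace)
    (b : OrthonormalBasis ι ℂ (EuclideanSpace ℂ ι))
    (h : ∀ (z : OrthonormalBasis ι ℂ (EuclideanSpace ℂ ι)) (s : Finset ι),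
        ∃ s' : Finset ι, s'.card = s.card ∧
        ∑ j ∈ s, (⟪z j, C.toEuclideanLin (z j)⟫_ℂ).re ≤
          ∑ j ∈ s', (⟪b j, B.toEuclideanLin (b j)⟫_ℂ).re) :
    OpMajorizes B C := by
  refine (opMajorizes_iff hB hC).2 ⟨htr, fun z s hs => ?_⟩
  obtain ⟨s', hs', hle⟩ := h z s
  have hBB : OpMajorizes B B := ⟨hB, hB, fun _ _ => le_rfl, rfl⟩
  refine hle.trans ?_
  rw [← hs'] at hs ⊢
  exact ((opMajorizes_iff hB hB).1 hBB).2 b s' hs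

/-- The operators majorized by a given one form a convex set. -/
theorem OpMajorizes.sum_smul {α : Type*} (A : Finset α) {B : Matrix ι ι ℂ}
    {C : α → Matrix ι ι ℂ} {w : α → ℝ} (hw0 : ∀ a ∈ A, 0 ≤ w a)
    (hw1 : ∑ a ∈ A, w a = 1)
    (h : ∀ a ∈ A, OpMajorizes B (C a)) : OpMajorizes B (∑ a ∈ A, w a • C a) := by
  have hA : A.Nonempty := by
    rw [Finset.nonempty_iff_ne_empty]
    rintro rfl
    simp at hw1
  obtain ⟨a₀, ha₀⟩ := hA
  obtain ⟨hB, -⟩ := h a₀ ha₀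
  have hC : (∑ a ∈ A, w a • C a).IsHermitian := by
    rw [Matrix.IsHermitian, Matrix.conjTranspose_sum]
    refine Finset.sum_congr rfl fun a ha => ?_
    obtain ⟨_, hCa, _⟩ := h a ha
    rw [Matrix.conjTranspose_smul, hCa.eq, star_trivial]
  have h' := fun a ha => (opMajorizes_iff hB (h a ha).choose_spec.choose).1 (h a ha)
  refine (opMajorizes_iff hB hC).2 ⟨?_, fun z s hs => ?_⟩
  · rw [Matrix.trace_sum]
    calc B.trace = ∑ a ∈ A, w a • B.trace := by rw [← Finset.sum_smul, hw1, one_smul]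
      _ = _ := Finset.sum_congr rfl fun a ha => by rw [Matrix.trace_smul, (h' a ha).1]
  · have hlin : ∀ x, (⟪x, (∑ a ∈ A, w a • C a).toEuclideanLin x⟫_ℂ).re =
        ∑ a ∈ A, w a * (⟪x, (C a).toEuclideanLin x⟫_ℂ).re := by
      intro x
      have : (∑ a ∈ A, w a • C a) = ∑ a ∈ A, (w a : ℂ) • C a := rfl
      rw [this, map_sum, LinearMap.sum_apply, inner_sum, Complex.re_sum]
      refine Finset.sum_congr rfl fun a _ => ?_
      rw [map_smul, LinearMap.smul_apply, inner_smul_right, Complex.re_ofReal_mul]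
    simp_rw [hlin]
    rw [Finset.sum_comm]
    simp_rw [← Finset.mul_sum]
    calc _ ≤ ∑ a ∈ A, w a * ∑ i with i.val < s.card, hB.eigenvalues₀ i :=
          Finset.sum_le_sum fun a ha =>
            mul_le_mul_of_nonneg_left ((h' a ha).2 z s hs) (hw0 a ha)
      _ = _ := by rw [← Finset.sum_mul, hw1, one_mul]

theorem OpMajorizes.unitary_conj {B C U : Matrix ι ι ℂ} (hU : U ∈ Matrix.unitaryGroup ι ℂ)
    (h : OpMajorizes B C) :
    OpMajorizes (U * B * U.conjTranspose) (U * C * U.conjTranspose) := by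
  obtain ⟨hB, hC, hBC⟩ := h
  have hU' : U.conjTranspose * U = 1 := Matrix.mem_unitaryGroup_iff'.1 hU
  have key : ∀ {A : Matrix ι ι ℂ} (hA : A.IsHermitian)
      (hA' : (U * A * U.conjTranspose).IsHermitian), hA'.eigenvalues₀ = hA.eigenvalues₀ := by
    intro A hA hA'
    rw [← List.ofFn_inj, ← Matrix.IsHermitian.sort_roots_charpoly_eq_eigenvalues₀,
      ← Matrix.IsHermitian.sort_roots_charpoly_eq_eigenvalues₀, Matrix.charpoly_mul_comm,
      ← mul_assoc, hU', one_mul]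
  refine ⟨Matrix.isHermitian_mul_mul_conjTranspose U hB,
    Matrix.isHermitian_mul_mul_conjTranspose U hC, ?_⟩
  rwa [key hB, key hC]

end Majorization

/-! ### Combinations of two projectors -/

section TwoProjections

/-- Among the `k`-element sets, one nested in the chain `D₁ ∩ D₂ ⊆ D₁ ⊆ D₁ ∪ D₂` collects the
largest total weight, when the points of `D₁` have weight `a`, those of `D₂` have weight `b ≤ a`
and weights add up on the intersection. That weight dominates `a p + b r` for all `p`, `r` subject
to the bounds that hold for the sums of two quadratic forms over `k` orthonormal vectors. -/
theorem Finset.exists_card_eq_le_mul_card_inter {ι : Type*} [Fintype ι] [DecidableEq ι]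
    (D₁ D₂ : Finset ι) {a b p r : ℝ} (hb : 0 ≤ b) (hab : b ≤ a) {k : ℕ} (hk : k ≤ Fintype.card ι)
    (hpk : p ≤ k) (hrk : r ≤ k) (hp : p ≤ D₁.card) (hr : r ≤ D₂.card)
    (hpr : p + r ≤ k + (D₁ ∩ D₂).card) :
    ∃ s : Finset ι, s.card = k ∧
      a * p + b * r ≤ a * (s ∩ D₁).card + b * (s ∩ D₂).card := by
  have ha : 0 ≤ a := hb.trans hab
  rcases le_total k (D₁ ∩ D₂).card with h1 | h1
  · obtain ⟨s, hs, hsk⟩ := Finset.exists_subset_card_eq h1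
    refine ⟨s, hsk, ?_⟩
    rw [Finset.inter_eq_left.2 (hs.trans Finset.inter_subset_left),
      Finset.inter_eq_left.2 (hs.trans Finset.inter_subset_right), hsk]
    nlinarith
  rcases le_total k D₁.card with h2 | h2
  · obtain ⟨s, hs1, hs2, hsk⟩ :=
      Finset.exists_subsuperset_card_eq (Finset.inter_subset_left (s₂ := D₂)) h1 h2
    refine ⟨s, hsk, ?_⟩
    have hle : ((D₁ ∩ D₂).card : ℝ) ≤ (s ∩ D₂).card := by
      exact_mod_cast Finset.card_le_card
        (Finset.subset_inter hs1 Finset.inter_subset_right)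
    rw [Finset.inter_eq_left.2 hs2, hsk]
    nlinarith
  have hunion := Finset.card_union_add_card_inter D₁ D₂
  rcases le_total k (D₁ ∪ D₂).card with h3 | h3
  · obtain ⟨s, hs1, hs2, hsk⟩ :=
      Finset.exists_subsuperset_card_eq (Finset.subset_union_left (s₂ := D₂)) h2 h3
    refine ⟨s, hsk, ?_⟩
    have hcount : (k : ℝ) + (D₁ ∩ D₂).card = D₁.card + (s ∩ D₂).card := by
      have := Finset.card_union_add_card_inter D₁ (s ∩ D₂)
      have e1 : D₁ ∪ (s ∩ D₂) = s := by
        ext x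
        have hx1 := @hs1 x
        have hx2 := @hs2 x
        simp only [Finset.mem_union, Finset.mem_inter] at *
        tauto
      have e2 : D₁ ∩ (s ∩ D₂) = D₁ ∩ D₂ := by
        rw [← Finset.inter_assoc, Finset.inter_eq_left.2 hs1]
      rw [e1, e2, hsk] at this
      exact_mod_cast this
    rw [Finset.inter_eq_right.2 hs1]
    nlinarith
  · obtain ⟨s, hs1, -, hsk⟩ :=
      Finset.exists_subsuperset_card_eq (Finset.subset_univ (D₁ ∪ D₂)) h3 hk
    refine ⟨s, hsk, ?_⟩
    rw [Finset.inter_eq_right.2 (Finset.subset_union_left.trans hs1),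
      Finset.inter_eq_right.2 (Finset.subset_union_right.trans hs1)]
    nlinarith

/-- The diagonal projector onto the span of the basis vectors in `D`. -/
def diagProj {ι : Type*} [DecidableEq ι] (D : Finset ι) : Matrix ι ι ℂ :=
  Matrix.diagonal fun x => if x ∈ D then 1 else 0

theorem isHermitian_diagProj {ι : Type*} [DecidableEq ι] (D : Finset ι) :
    (diagProj D).IsHermitian := by
  rw [Matrix.IsHermitian, diagProj, Matrix.diagonal_conjTranspose]
  congr 1
  ext x
  simp only [Pi.star_apply]
  split_ifs <;> simp

variable {ι : Type*} [Fintype ι] [DecidableEq ι]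

theorem IsStarProjection.isSymmetricProjection_toEuclideanLin {P : Matrix ι ι ℂ}
    (hP : IsStarProjection P) : P.toEuclideanLin.IsSymmetricProjection where
  isIdempotentElem := by
    have := hP.isIdempotentElem
    rw [IsIdempotentElem] at this ⊢
    ext1 x
    change P.toEuclideanLin (P.toEuclideanLin x) = _
    rw [Matrix.toLpLin_apply, Matrix.toLpLin_apply]
    simp [Matrix.mulVec_mulVec, this]
  isSymmetric := Matrix.isSymmetric_toEuclideanLin_iff.2 hP.isSelfAdjoint

theorem Matrix.sum_re_inner_toEuclideanLin (A : Matrix ι ι ℂ)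
    (z : OrthonormalBasis ι ℂ (EuclideanSpace ℂ ι)) :
    ∑ j, (⟪z j, A.toEuclideanLin (z j)⟫_ℂ).re = A.trace.re := by
  rw [← Complex.re_sum, ← LinearMap.trace_eq_sum_inner]
  congr 1
  rw [LinearMap.trace_eq_matrix_trace ℂ (EuclideanSpace.basisFun ι ℂ).toBasis]
  congr 1
  rw [Matrix.toEuclideanLin_eq_toLin_orthonormal, LinearMap.toMatrix_toLin]

theorem IsStarProjection.sum_re_inner_le_trace {P : Matrix ι ι ℂ} (hP : IsStarProjection P)
    (z : OrthonormalBasis ι ℂ (EuclideanSpace ℂ ι)) (s : Finset ι) :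
    ∑ j ∈ s, (⟪z j, P.toEuclideanLin (z j)⟫_ℂ).re ≤ P.trace.re := by
  rw [← P.sum_re_inner_toEuclideanLin z]
  exact Finset.sum_le_univ_sum_of_nonneg fun j =>
    hP.isSymmetricProjection_toEuclideanLin.re_inner_map_self_nonneg _

theorem IsStarProjection.sum_re_inner_le_card {P : Matrix ι ι ℂ} (hP : IsStarProjection P)
    (z : OrthonormalBasis ι ℂ (EuclideanSpace ℂ ι)) (s : Finset ι) :
    ∑ j ∈ s, (⟪z j, P.toEuclideanLin (z j)⟫_ℂ).re ≤ s.card := by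
  have := Finset.sum_le_sum fun j (_ : j ∈ s) =>
    hP.isSymmetricProjection_toEuclideanLin.re_inner_map_self_le (z j)
  simpa [z.orthonormal.1] using this

theorem trace_diagProj (D : Finset ι) : (diagProj D).trace = D.card := by
  simp [diagProj, Matrix.trace_diagonal]

theorem sum_re_inner_diagProj (D s : Finset ι) :
    ∑ j ∈ s, (⟪EuclideanSpace.basisFun ι ℂ j,
      (diagProj D).toEuclideanLin (EuclideanSpace.basisFun ι ℂ j)⟫_ℂ).re = (s ∩ D).card := by
  have : ∀ j, (⟪EuclideanSpace.basisFun ι ℂ j,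
      (diagProj D).toEuclideanLin (EuclideanSpace.basisFun ι ℂ j)⟫_ℂ).re =
        if j ∈ D then 1 else 0 := by
    intro j
    rw [EuclideanSpace.basisFun_apply, EuclideanSpace.inner_single_left]
    by_cases h : j ∈ D <;> simp [diagProj, Matrix.toLpLin_apply, h]
  simp_rw [this]
  rw [Finset.sum_boole, Finset.filter_mem_eq_inter]

theorem re_inner_toEuclideanLin_smul_add_smul (A B : Matrix ι ι ℂ) (a b : ℝ)
    (x : EuclideanSpace ℂ ι) :
    (⟪x, (a • A + b • B).toEuclideanLin x⟫_ℂ).re =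
      a * (⟪x, A.toEuclideanLin x⟫_ℂ).re + b * (⟪x, B.toEuclideanLin x⟫_ℂ).re := by
  have : a • A + b • B = (a : ℂ) • A + (b : ℂ) • B := rfl
  rw [this, map_add, map_smul, map_smul, LinearMap.add_apply, LinearMap.smul_apply,
    LinearMap.smul_apply, inner_add_right, inner_smul_right, inner_smul_right, Complex.add_re,
    Complex.re_ofReal_mul, Complex.re_ofReal_mul]

/-- The case `b ≤ a` of `opMajorizes_smul_add_smul`. -/
theorem opMajorizes_smul_add_smul_of_le {P R : Matrix ι ι ℂ} (hP : IsStarProjection P)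
    (hR : IsStarProjection R) {D₁ D₂ : Finset ι} (hD₁ : P.trace = D₁.card)
    (hD₂ : R.trace = D₂.card) {α : Type*} (A : Finset α) (e f : α → EuclideanSpace ℂ ι)
    (hPR : P * R = ∑ a ∈ A, Matrix.vecMulVec (e a).ofLp (star (f a).ofLp))
    (he : ∑ a ∈ A, ‖e a‖ ^ 2 ≤ (D₁ ∩ D₂).card) (hf : ∑ a ∈ A, ‖f a‖ ^ 2 ≤ (D₁ ∩ D₂).card)
    {a b : ℝ} (hb : 0 ≤ b) (hab : b ≤ a) :
    OpMajorizes (a • diagProj D₁ + b • diagProj D₂) (a • P + b • R) := by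
  have hherm : ∀ {X Y : Matrix ι ι ℂ}, X.IsHermitian → Y.IsHermitian →
      (a • X + b • Y).IsHermitian := by
    intro X Y hX hY
    rw [Matrix.IsHermitian, Matrix.conjTranspose_add, Matrix.conjTranspose_smul,
      Matrix.conjTranspose_smul, hX.eq, hY.eq, star_trivial, star_trivial]
  refine opMajorizes_of_forall_exists
    (hherm (isHermitian_diagProj D₁) (isHermitian_diagProj D₂))
    (hherm hP.isSelfAdjoint hR.isSelfAdjoint) ?_ (EuclideanSpace.basisFun ι ℂ) fun z s => ?_
  · simp only [Matrix.trace_add, Matrix.trace_smul, trace_diagProj, hD₁, hD₂]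
  have hPR' : ∀ x, P.toEuclideanLin (R.toEuclideanLin x) = ∑ a ∈ A, ⟪f a, x⟫_ℂ • e a := by
    intro x
    have h1 : P.toEuclideanLin (R.toEuclideanLin x) = (P * R).toEuclideanLin x := by
      simp [Matrix.toLpLin_apply, Matrix.mulVec_mulVec]
    rw [h1, hPR, map_sum, LinearMap.sum_apply]
    refine Finset.sum_congr rfl fun a _ => ?_
    ext i
    simp [Matrix.toLpLin_apply, Matrix.vecMulVec_mulVec,
      EuclideanSpace.inner_eq_star_dotProduct, dotProduct_comm]
  have hpr := hP.isSymmetricProjection_toEuclideanLin.sum_re_inner_add_le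
    hR.isSymmetricProjection_toEuclideanLin A e f hPR' z.orthonormal s
  rw [Finset.sum_add_distrib, Finset.sum_add_distrib] at hpr
  have hp := hP.sum_re_inner_le_trace z s
  have hr := hR.sum_re_inner_le_trace z s
  rw [hD₁, Complex.natCast_re] at hp
  rw [hD₂, Complex.natCast_re] at hr
  obtain ⟨s', hs', hle⟩ := Finset.exists_card_eq_le_mul_card_inter D₁ D₂ hb hab
    (Finset.card_le_univ s) (hP.sum_re_inner_le_card z s) (hR.sum_re_inner_le_card z s) hp hr
    (by linarith)
  refine ⟨s', hs', ?_⟩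
  simp_rw [re_inner_toEuclideanLin_smul_add_smul, Finset.sum_add_distrib, ← Finset.mul_sum]
  rwa [sum_re_inner_diagProj, sum_re_inner_diagProj]

/-- Let `P`, `R` be projectors of ranks `|D₁|`, `|D₂|` such that `PR` has trace norm at
most `|D₁ ∩ D₂|`, as witnessed by a decomposition into rank-one operators. Then any combination
`aP + bR` is majorized by the one formed with the commuting coordinate projectors onto `D₁`
and `D₂`. -/
theorem opMajorizes_smul_add_smul {P R : Matrix ι ι ℂ} (hP : IsStarProjection P)
    (hR : IsStarProjection R) {D₁ D₂ : Finset ι} (hD₁ : P.trace = D₁.card)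
    (hD₂ : R.trace = D₂.card) {α : Type*} (A : Finset α) (e f : α → EuclideanSpace ℂ ι)
    (hPR : P * R = ∑ a ∈ A, Matrix.vecMulVec (e a).ofLp (star (f a).ofLp))
    (he : ∑ a ∈ A, ‖e a‖ ^ 2 ≤ (D₁ ∩ D₂).card) (hf : ∑ a ∈ A, ‖f a‖ ^ 2 ≤ (D₁ ∩ D₂).card)
    {a b : ℝ} (ha : 0 ≤ a) (hb : 0 ≤ b) :
    OpMajorizes (a • diagProj D₁ + b • diagProj D₂) (a • P + b • R) := by
  rcases le_total b a with hab | hab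
  · exact opMajorizes_smul_add_smul_of_le hP hR hD₁ hD₂ A e f hPR he hf hb hab
  · rw [add_comm (a • diagProj D₁), add_comm (a • P)]
    refine opMajorizes_smul_add_smul_of_le hR hP hD₂ hD₁ A f e ?_ ?_ ?_ ha hab
    · have := congrArg Matrix.conjTranspose hPR
      have hP' : P.conjTranspose = P := hP.isSelfAdjoint
      have hR' : R.conjTranspose = R := hR.isSelfAdjoint
      rw [Matrix.conjTranspose_mul, hP', hR', Matrix.conjTranspose_sum] at this
      simpa [Matrix.conjTranspose_vecMulVec] using this
    · rwa [Finset.inter_comm]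
    · rwa [Finset.inter_comm]

end TwoProjections

/-! ### Tensor products of operators on qudits -/

section Tensor

theorem conjTranspose_ketbra {ι : Type*} (ψ : EuclideanSpace ℂ ι) :
    (ketbra ψ).conjTranspose = ketbra ψ := by
  simp [ketbra, Matrix.conjTranspose_vecMulVec]

theorem trace_ketbra_eq_norm_sq {ι : Type*} [Fintype ι] (ψ : EuclideanSpace ℂ ι) :
    (ketbra ψ).trace = (‖ψ‖ : ℂ) ^ 2 := by
  rw [ketbra, Matrix.trace_vecMulVec, ← EuclideanSpace.inner_eq_star_dotProduct,
    inner_self_eq_norm_sq_to_K]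
  rfl

theorem trace_ketbra {ι : Type*} [Fintype ι] {ψ : EuclideanSpace ℂ ι} (hψ : ‖ψ‖ = 1) :
    (ketbra ψ).trace = 1 := by
  simp [trace_ketbra_eq_norm_sq, hψ]

theorem mul_ketbra_mul_conjTranspose {ι : Type*} [Fintype ι] (U : Matrix ι ι ℂ)
    (ψ : EuclideanSpace ℂ ι) :
    U * ketbra ψ * U.conjTranspose = ketbra (WithLp.toLp 2 (U.mulVec ψ.ofLp)) := by
  rw [ketbra, ketbra, Matrix.mul_vecMulVec, Matrix.vecMulVec_mul, Matrix.star_mulVec]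

theorem exists_ketbra_eq_unitary_conj {ι : Type*} [Fintype ι] [DecidableEq ι] {U : Matrix ι ι ℂ}
    (hU : U ∈ Matrix.unitaryGroup ι ℂ) {ψ : EuclideanSpace ℂ ι} (hψ : ‖ψ‖ = 1) :
    ∃ φ : EuclideanSpace ℂ ι, ‖φ‖ = 1 ∧ ketbra ψ = U * ketbra φ * U.conjTranspose := by
  have h1 : U * U.conjTranspose = 1 := Matrix.mem_unitaryGroup_iff.1 hU
  refine ⟨WithLp.toLp 2 (U.conjTranspose.mulVec ψ.ofLp), ?_, ?_⟩
  · have h := trace_ketbra_eq_norm_sq (WithLp.toLp 2 (U.conjTranspose.mulVec ψ.ofLp))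
    rw [← mul_ketbra_mul_conjTranspose, Matrix.conjTranspose_conjTranspose,
      Matrix.trace_mul_cycle, h1, one_mul, trace_ketbra hψ] at h
    have h' : ‖(WithLp.toLp 2 (U.conjTranspose.mulVec ψ.ofLp) : EuclideanSpace ℂ ι)‖ ^ 2 = 1 := by
      exact_mod_cast h.symm
    exact (pow_eq_one_iff_of_nonneg (norm_nonneg _) two_ne_zero).1 h'
  · rw [mul_ketbra_mul_conjTranspose, Matrix.mulVec_mulVec, h1, Matrix.one_mulVec]

theorem isStarProjection_ketbra {ι : Type*} [Fintype ι] {ψ : EuclideanSpace ℂ ι}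
    (hψ : ‖ψ‖ = 1) : IsStarProjection (ketbra ψ) where
  isIdempotentElem := by
    have h := trace_ketbra hψ
    rw [ketbra, Matrix.trace_vecMulVec, dotProduct_comm] at h
    rw [IsIdempotentElem, ketbra, Matrix.vecMulVec_mul_vecMulVec, h, one_smul]
  isSelfAdjoint := conjTranspose_ketbra ψ

theorem ketbra_single {ι : Type*} [DecidableEq ι] (i : ι) :
    ketbra (EuclideanSpace.single i 1) = diagProj {i} := by
  ext x y
  by_cases hx : x = i <;> by_cases hy : y = i <;> by_cases hxy : x = y <;>
    simp_all [ketbra, diagProj, Matrix.vecMulVec_apply]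

theorem diagProj_univ {ι : Type*} [Fintype ι] [DecidableEq ι] :
    diagProj (Finset.univ : Finset ι) = 1 := by
  simp [diagProj]

theorem isStarProjection_diagProj {ι : Type*} [Fintype ι] [DecidableEq ι] (D : Finset ι) :
    IsStarProjection (diagProj D) where
  isIdempotentElem := by simp [IsIdempotentElem, diagProj]
  isSelfAdjoint := isHermitian_diagProj D

/-- The tensor power of a matrix over an arbitrary finite set of sites. -/
def piPow (κ : Type*) [Fintype κ] {d : ℕ} (A : Matrix (Fin d) (Fin d) ℂ) :
    Matrix (κ → Fin d) (κ → Fin d) ℂ :=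
  Matrix.of fun x y => ∏ j, A (x j) (y j)

section piPow

variable {κ : Type*} [Fintype κ] {d : ℕ}

theorem tensorPow_eq_piPow {n : ℕ} (J : Finset (Fin n)) (A : Matrix (Fin d) (Fin d) ℂ) :
    tensorPow J A = piPow J A := rfl

theorem piPow_mul [DecidableEq κ] (A B : Matrix (Fin d) (Fin d) ℂ) :
    piPow κ A * piPow κ B = piPow κ (A * B) := by
  ext x y
  simp only [piPow, Matrix.mul_apply, Matrix.of_apply]
  rw [Finset.prod_univ_sum, Fintype.piFinset_univ]
  simp [Finset.prod_mul_distrib]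

theorem conjTranspose_piPow (A : Matrix (Fin d) (Fin d) ℂ) :
    (piPow κ A).conjTranspose = piPow κ A.conjTranspose := by
  ext x y
  simp [piPow, Matrix.conjTranspose_apply]

theorem piPow_smul (c : ℝ) (A : Matrix (Fin d) (Fin d) ℂ) :
    piPow κ (c • A) = c ^ Fintype.card κ • piPow κ A := by
  ext x y
  simp [piPow, Finset.prod_mul_distrib]

theorem piPow_diagProj [DecidableEq κ] (S : Finset (Fin d)) :
    piPow κ (diagProj S) = diagProj (Fintype.piFinset fun _ : κ => S) := by
  ext x y
  simp only [piPow, diagProj, Matrix.of_apply, Matrix.diagonal_apply, Fintype.mem_piFinset]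
  by_cases hxy : x = y
  · subst hxy
    simp [Finset.prod_ite_zero]
  · obtain ⟨j, hj⟩ := Function.ne_iff.1 hxy
    rw [if_neg hxy]
    exact Finset.prod_eq_zero (Finset.mem_univ j) (if_neg hj)

theorem piPow_one [DecidableEq κ] : piPow κ (1 : Matrix (Fin d) (Fin d) ℂ) = 1 := by
  rw [← diagProj_univ, piPow_diagProj, Fintype.piFinset_univ, diagProj_univ]

theorem piPow_mem_unitaryGroup [DecidableEq κ] {U : Matrix (Fin d) (Fin d) ℂ}
    (hU : U ∈ Matrix.unitaryGroup (Fin d) ℂ) :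
    piPow κ U ∈ Matrix.unitaryGroup (κ → Fin d) ℂ := by
  rw [Matrix.mem_unitaryGroup_iff] at hU ⊢
  rw [Matrix.star_eq_conjTranspose] at hU ⊢
  rw [conjTranspose_piPow, piPow_mul, hU, piPow_one]

end piPow

variable {d n : ℕ}

/-- A basis label of `(ℂ^d)^{⊗n}` as a pair of labels for the sites in `I` and in `Iᶜ`. -/
def restrictEquiv (d : ℕ) {n : ℕ} (I : Finset (Fin n)) :
    (Fin n → Fin d) ≃ (I → Fin d) × ((Iᶜ : Finset (Fin n)) → Fin d) where
  toFun x := (fun i => x i, fun i => x i)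
  invFun p j := if h : j ∈ I then p.1 ⟨j, h⟩ else p.2 ⟨j, Finset.mem_compl.2 h⟩
  left_inv x := by
    ext j
    by_cases h : j ∈ I <;> simp [h]
  right_inv p := by
    refine Prod.ext (funext fun i => ?_) (funext fun i => ?_)
    · simp
    · simp [Finset.mem_compl.1 i.2]

theorem sum_mul_restrict (I : Finset (Fin n)) (F : (I → Fin d) → ℂ)
    (G : ((Iᶜ : Finset (Fin n)) → Fin d) → ℂ) :
    ∑ x : Fin n → Fin d, F (fun i => x i) * G (fun i => x i) = (∑ u, F u) * ∑ v, G v := by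
  rw [Finset.sum_mul_sum, ← Fintype.sum_prod_type']
  exact Fintype.sum_equiv (restrictEquiv d I) _ _ fun x => rfl

theorem tensorCompl_mul (I : Finset (Fin n)) (A A' : Matrix (I → Fin d) (I → Fin d) ℂ)
    (B B' : Matrix ((Iᶜ : Finset (Fin n)) → Fin d) ((Iᶜ : Finset (Fin n)) → Fin d) ℂ) :
    tensorCompl I A B * tensorCompl I A' B' = tensorCompl I (A * A') (B * B') := by
  ext x y
  simp only [tensorCompl, Matrix.mul_apply, Matrix.of_apply]
  rw [← sum_mul_restrict]
  exact Finset.sum_congr rfl fun w _ => by ring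

theorem conjTranspose_tensorCompl (I : Finset (Fin n)) (A : Matrix (I → Fin d) (I → Fin d) ℂ)
    (B : Matrix ((Iᶜ : Finset (Fin n)) → Fin d) ((Iᶜ : Finset (Fin n)) → Fin d) ℂ) :
    (tensorCompl I A B).conjTranspose = tensorCompl I A.conjTranspose B.conjTranspose := by
  ext x y
  simp [tensorCompl, Matrix.conjTranspose_apply]

theorem trace_tensorCompl (I : Finset (Fin n)) (A : Matrix (I → Fin d) (I → Fin d) ℂ)
    (B : Matrix ((Iᶜ : Finset (Fin n)) → Fin d) ((Iᶜ : Finset (Fin n)) → Fin d) ℂ) :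
    (tensorCompl I A B).trace = A.trace * B.trace :=
  sum_mul_restrict I (fun u => A u u) (fun v => B v v)

theorem tensorCompl_smul (I : Finset (Fin n)) (A : Matrix (I → Fin d) (I → Fin d) ℂ) (c : ℝ)
    (B : Matrix ((Iᶜ : Finset (Fin n)) → Fin d) ((Iᶜ : Finset (Fin n)) → Fin d) ℂ) :
    tensorCompl I A (c • B) = c • tensorCompl I A B := by
  ext x y
  simp only [tensorCompl, Matrix.of_apply, Matrix.smul_apply, Complex.real_smul]
  ring

theorem sum_smul_tensorCompl {α : Type*} [Fintype α] (I : Finset (Fin n)) (w : α → ℝ)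
    (A : α → Matrix (I → Fin d) (I → Fin d) ℂ)
    (B : Matrix ((Iᶜ : Finset (Fin n)) → Fin d) ((Iᶜ : Finset (Fin n)) → Fin d) ℂ) :
    tensorCompl I (∑ a, w a • A a) B = ∑ a, w a • tensorCompl I (A a) B := by
  ext x y
  simp only [tensorCompl, Matrix.of_apply, Matrix.sum_apply, Matrix.smul_apply,
    Complex.real_smul, Finset.sum_mul, mul_assoc]

theorem IsStarProjection.tensorCompl {I : Finset (Fin n)}
    {A : Matrix (I → Fin d) (I → Fin d) ℂ}
    {B : Matrix ((Iᶜ : Finset (Fin n)) → Fin d) ((Iᶜ : Finset (Fin n)) → Fin d) ℂ}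
    (hA : IsStarProjection A) (hB : IsStarProjection B) :
    IsStarProjection (tensorCompl I A B) where
  isIdempotentElem := by
    rw [IsIdempotentElem, tensorCompl_mul, hA.isIdempotentElem.eq, hB.isIdempotentElem.eq]
  isSelfAdjoint := by
    have hA' : A.conjTranspose = A := hA.isSelfAdjoint
    have hB' : B.conjTranspose = B := hB.isSelfAdjoint
    change (_root_.tensorCompl I A B).conjTranspose = _
    rw [conjTranspose_tensorCompl, hA', hB']

theorem tensorCompl_tensorPow (I : Finset (Fin n)) (A : Matrix (Fin d) (Fin d) ℂ) :
    tensorCompl I (tensorPow I A) (tensorPow Iᶜ A) = piPow (Fin n) A := by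
  ext x y
  simp only [tensorCompl, tensorPow, piPow, Matrix.of_apply]
  rw [Finset.prod_coe_sort I fun j => A (x j) (y j),
    Finset.prod_coe_sort Iᶜ fun j => A (x j) (y j), Finset.prod_mul_prod_compl]

theorem piPow_conj_tensorCompl (I : Finset (Fin n)) (U : Matrix (Fin d) (Fin d) ℂ)
    (A : Matrix (I → Fin d) (I → Fin d) ℂ) (Q : Matrix (Fin d) (Fin d) ℂ) :
    piPow (Fin n) U * tensorCompl I A (tensorPow Iᶜ Q) * (piPow (Fin n) U).conjTranspose =
      tensorCompl I (tensorPow I U * A * (tensorPow I U).conjTranspose)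
        (tensorPow Iᶜ (U * Q * U.conjTranspose)) := by
  rw [← tensorCompl_tensorPow I U, conjTranspose_tensorCompl, tensorCompl_mul, tensorCompl_mul]
  simp only [tensorPow_eq_piPow, conjTranspose_piPow, piPow_mul]

theorem tensorCompl_ketbra_apply (S : Finset (Fin d)) (I : Finset (Fin n))
    (ψ : EuclideanSpace ℂ (I → Fin d)) (x y : Fin n → Fin d) :
    tensorCompl I (ketbra ψ) (tensorPow Iᶜ (diagProj S)) x y =
      if ∀ j, j ∉ I → x j = y j ∧ x j ∈ S then
        ψ (fun i => x i) * star (ψ fun i => y i) else 0 := by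
  rw [tensorPow_eq_piPow, piPow_diagProj]
  have hxy : (∀ j, j ∉ I → x j = y j ∧ x j ∈ S) ↔
      ((fun i : (Iᶜ : Finset (Fin n)) => x i) = (fun i : (Iᶜ : Finset (Fin n)) => y i)) ∧
        (fun i : (Iᶜ : Finset (Fin n)) => x i) ∈ Fintype.piFinset fun _ => S := by
    simp only [funext_iff, Fintype.mem_piFinset, Subtype.forall, Finset.mem_compl]
    exact ⟨fun h => ⟨fun j hj => (h j hj).1, fun j hj => (h j hj).2⟩,
      fun h j hj => ⟨h.1 j hj, h.2 j hj⟩⟩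
  rw [if_congr hxy rfl rfl, ite_and]
  simp only [tensorCompl, diagProj, Matrix.of_apply, Matrix.diagonal_apply, ketbra,
    Matrix.vecMulVec_apply, Pi.star_apply, mul_ite, mul_one, mul_zero]

end Tensor

/-! ### The product of two partially pure projectors -/

section Aligned

variable {d n : ℕ} [NeZero d]

/-- The labels of the basis vectors spanning the range of
`|e₀⟩⟨e₀|^{⊗ I} ⊗ (diagProj S)^{⊗ Iᶜ}`. -/
def alignedSet (S : Finset (Fin d)) (I : Finset (Fin n)) : Finset (Fin n → Fin d) :=
  Finset.univ.filter fun x => (∀ j ∈ I, x j = 0) ∧ ∀ j, j ∉ I → x j ∈ S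

theorem tensorCompl_single_eq_diagProj (S : Finset (Fin d)) (I : Finset (Fin n)) :
    tensorCompl I (tensorPow I (ketbra (EuclideanSpace.single 0 1))) (tensorPow Iᶜ (diagProj S)) =
      diagProj (alignedSet S I) := by
  rw [ketbra_single, tensorPow_eq_piPow, tensorPow_eq_piPow, piPow_diagProj, piPow_diagProj]
  ext x y
  have hxy : x = y ↔ (fun i : I => x i) = (fun i : I => y i) ∧
      (fun i : (Iᶜ : Finset (Fin n)) => x i) = (fun i : (Iᶜ : Finset (Fin n)) => y i) :=
    (restrictEquiv d I).injective.eq_iff.symm.trans Prod.ext_iff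
  simp only [tensorCompl, diagProj, Matrix.of_apply, Matrix.diagonal_apply, alignedSet, hxy,
    Fintype.mem_piFinset, Finset.mem_filter, Finset.mem_univ, true_and, Finset.mem_singleton,
    Subtype.forall, Finset.mem_compl]
  split_ifs <;> simp_all

theorem trace_tensorCompl_ketbra (S : Finset (Fin d)) {I : Finset (Fin n)}
    {ψ : EuclideanSpace ℂ (I → Fin d)} (hψ : ‖ψ‖ = 1) :
    (tensorCompl I (ketbra ψ) (tensorPow Iᶜ (diagProj S))).trace = (alignedSet S I).card := by
  rw [← trace_diagProj, ← tensorCompl_single_eq_diagProj, trace_tensorCompl, trace_tensorCompl,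
    trace_ketbra hψ, ketbra_single, tensorPow_eq_piPow I, piPow_diagProj, trace_diagProj]
  simp

/-- The left vectors of the rank-one decomposition of the product of the projectors
`|ψ⟩⟨ψ|_I ⊗ (diagProj S)^{⊗ Iᶜ}` and `|φ⟩⟨φ|_J ⊗ (diagProj S)^{⊗ Jᶜ}`; the right vectors arise by
exchanging the roles of the two factors. The label `z` matters only on `I ∩ J` and off `I ∪ J`:
the vector is the product of `ψ`, of `φ` with its factors in `I ∩ J` contracted with `z`, and of
the basis vector `z` off `I ∪ J`, projected at all sites off `I` by `diagProj S`. -/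
noncomputable def crossVec (S : Finset (Fin d)) (I J : Finset (Fin n))
    (ψ : EuclideanSpace ℂ (I → Fin d)) (φ : EuclideanSpace ℂ (J → Fin d)) (z : Fin n → Fin d) :
    EuclideanSpace ℂ (Fin n → Fin d) :=
  WithLp.toLp 2 fun x =>
    if ∀ j, j ∉ I → x j ∈ S ∧ (j ∉ J → x j = z j) then
      ψ (fun i => x i) * φ (fun j => if (j : Fin n) ∈ I then z j else x j) else 0

/-- Labels of the sites in `(I ∩ J) ∪ (I ∪ J)ᶜ`, extended by `0` to the other sites. -/
def crossLabels (d : ℕ) [NeZero d] (I J : Finset (Fin n)) : Finset (Fin n → Fin d) :=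
  Finset.univ.filter fun z => ∀ j, ¬(j ∈ I ↔ j ∈ J) → z j = 0

theorem crossLabels_comm (I J : Finset (Fin n)) : crossLabels d I J = crossLabels d J I := by
  ext z
  simp only [crossLabels, iff_comm]

theorem tensorCompl_ketbra_mul (S : Finset (Fin d)) (I J : Finset (Fin n))
    (ψ : EuclideanSpace ℂ (I → Fin d)) (φ : EuclideanSpace ℂ (J → Fin d)) :
    tensorCompl I (ketbra ψ) (tensorPow Iᶜ (diagProj S)) *
        tensorCompl J (ketbra φ) (tensorPow Jᶜ (diagProj S)) =
      ∑ z ∈ crossLabels d I J, Matrix.vecMulVec (crossVec S I J ψ φ z).ofLp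
        (star (crossVec S J I φ ψ z).ofLp) := by
  ext x y
  simp only [Matrix.mul_apply, tensorCompl_ketbra_apply, Matrix.sum_apply,
    Matrix.vecMulVec_apply, Pi.star_apply, crossVec]
  simp only [apply_ite star, star_zero, ite_zero_mul_ite_zero]
  rw [← Finset.sum_filter, ← Finset.sum_filter]
  -- The intermediate label agrees with `x` off `I` and with `y` off `J`.
  refine Finset.sum_nbij' (fun w j => if j ∈ I ↔ j ∈ J then w j else 0)
    (fun z j => if j ∈ I ↔ j ∈ J then z j else if j ∈ I then y j else x j) ?_ ?_ ?_ ?_ ?_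
  · intro w hw
    simp only [Finset.mem_filter, Finset.mem_univ, true_and, crossLabels] at hw ⊢
    grind
  · intro z hz
    simp only [Finset.mem_filter, Finset.mem_univ, true_and, crossLabels] at hz ⊢
    grind
  · intro w hw
    simp only [Finset.mem_filter, Finset.mem_univ, true_and] at hw
    ext1 j
    grind
  · intro z hz
    simp only [Finset.mem_filter, Finset.mem_univ, true_and, crossLabels] at hz
    ext1 j
    grind
  · intro w hw
    simp only [Finset.mem_filter, Finset.mem_univ, true_and] at hw
    have e1 : (fun i : I => w i) = fun i : I =>
        if (i : Fin n) ∈ J then (if (i : Fin n) ∈ I ↔ (i : Fin n) ∈ J then w i else 0)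
        else y i := by
      ext1 i
      have := i.2
      grind
    have e2 : (fun i : J => w i) = fun i : J =>
        if (i : Fin n) ∈ I then (if (i : Fin n) ∈ I ↔ (i : Fin n) ∈ J then w i else 0)
        else x i := by
      ext1 i
      have := i.2
      grind
    rw [e1, e2]
    simp only [star_mul']
    ring

/-- The squared norms of the vectors of the decomposition sum to at most the dimension of the
intersection of the two aligned ranges. -/
theorem sum_norm_crossVec_sq_le {S : Finset (Fin d)} (hS : 0 ∈ S) (I J : Finset (Fin n))
    {ψ : EuclideanSpace ℂ (I → Fin d)} {φ : EuclideanSpace ℂ (J → Fin d)} (hψ : ‖ψ‖ = 1)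
    (hφ : ‖φ‖ = 1) :
    ∑ z ∈ crossLabels d I J, ‖crossVec S I J ψ φ z‖ ^ 2 ≤
      (alignedSet S I ∩ alignedSet S J).card := by
  simp_rw [EuclideanSpace.norm_sq_eq, crossVec]
  rw [← Finset.sum_product']
  have h1 : ∀ p : (Fin n → Fin d) × (Fin n → Fin d),
      ‖(if ∀ j, j ∉ I → p.2 j ∈ S ∧ (j ∉ J → p.2 j = p.1 j) then
        ψ (fun i => p.2 i) * φ (fun j => if (j : Fin n) ∈ I then p.1 j else p.2 j) else 0)‖ ^ 2 =
      if ∀ j, j ∉ I → p.2 j ∈ S ∧ (j ∉ J → p.2 j = p.1 j) then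
        ‖ψ (fun i => p.2 i)‖ ^ 2 *
          ‖φ (fun j => if (j : Fin n) ∈ I then p.1 j else p.2 j)‖ ^ 2 else 0 := by
    intro p
    split_ifs <;> simp [mul_pow]
  simp_rw [h1]
  rw [← Finset.sum_filter]
  -- The pair of labels is determined by the arguments of `ψ` and `φ` and by its values
  -- off `I ∪ J`, so the sum is dominated by a product of three independent sums.
  let F : (Fin n → Fin d) × (Fin n → Fin d) → ((I → Fin d) × (J → Fin d)) × (Fin n → Fin d) :=
    fun p => ((fun i => p.2 i, fun j => if (j : Fin n) ∈ I then p.1 j else p.2 j),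
      fun j => if j ∈ I ∨ j ∈ J then 0 else p.2 j)
  let g : ((I → Fin d) × (J → Fin d)) × (Fin n → Fin d) → ℝ :=
    fun q => ‖ψ q.1.1‖ ^ 2 * ‖φ q.1.2‖ ^ 2
  set T := (crossLabels d I J ×ˢ (Finset.univ : Finset (Fin n → Fin d))).filter
    fun p => ∀ j, j ∉ I → p.2 j ∈ S ∧ (j ∉ J → p.2 j = p.1 j) with hT
  have hinj : Set.InjOn F T := by
    intro p hp q hq hpq
    simp only [hT, Finset.coe_filter, Finset.mem_product, Finset.mem_univ, and_true,
      crossLabels, Finset.mem_filter, true_and, Set.mem_ofPred_eq] at hp hq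
    simp only [F, Prod.mk.injEq, funext_iff, Subtype.forall] at hpq
    obtain ⟨⟨hu, hv⟩, hw⟩ := hpq
    have h2 : p.2 = q.2 := by
      ext1 j
      have := hu j
      have := hv j
      have := hw j
      grind
    have h1 : p.1 = q.1 := by
      ext1 j
      have := hv j
      have := congrFun h2 j
      have := hp.1 j
      have := hq.1 j
      have := hp.2 j
      have := hq.2 j
      grind
    exact Prod.ext h1 h2
  calc ∑ p ∈ T, g (F p) = ∑ q ∈ T.image F, g q := (Finset.sum_image hinj).symm
    _ ≤ ∑ q ∈ (Finset.univ : Finset ((I → Fin d) × (J → Fin d))) ×ˢ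
          (alignedSet S I ∩ alignedSet S J), g q := by
      refine Finset.sum_le_sum_of_subset_of_nonneg ?_ fun q _ _ => by positivity
      intro q hq
      obtain ⟨p, hp, rfl⟩ := Finset.mem_image.1 hq
      simp only [hT, Finset.mem_filter] at hp
      simp only [F, Finset.mem_product, Finset.mem_univ, true_and, Finset.mem_inter, alignedSet,
        Finset.mem_filter]
      grind
    _ = (alignedSet S I ∩ alignedSet S J).card := by
      rw [Finset.sum_product_right]
      have hone : ∑ q : (I → Fin d) × (J → Fin d), ‖ψ q.1‖ ^ 2 * ‖φ q.2‖ ^ 2 = 1 := by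
        rw [Fintype.sum_prod_type]
        simp only
        rw [← Finset.sum_mul_sum, ← EuclideanSpace.norm_sq_eq, ← EuclideanSpace.norm_sq_eq, hψ, hφ]
        norm_num
      simp [g, hone]

/-- Spin alignment for two pure states when `Q` is a coordinate projector and the first basis
vector takes the place of `q₀`. -/
theorem opMajorizes_diagProj {S : Finset (Fin d)} (hS : 0 ∈ S) (I J : Finset (Fin n))
    {ψ : EuclideanSpace ℂ (I → Fin d)} {φ : EuclideanSpace ℂ (J → Fin d)} (hψ : ‖ψ‖ = 1)
    (hφ : ‖φ‖ = 1) {a b : ℝ} (ha : 0 ≤ a) (hb : 0 ≤ b) :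
    OpMajorizes (a • diagProj (alignedSet S I) + b • diagProj (alignedSet S J))
      (a • tensorCompl I (ketbra ψ) (tensorPow Iᶜ (diagProj S)) +
        b • tensorCompl J (ketbra φ) (tensorPow Jᶜ (diagProj S))) := by
  have hproj : ∀ {κ : Type} [Fintype κ] [DecidableEq κ],
      IsStarProjection (piPow κ (diagProj S)) := by
    intro κ _ _
    rw [piPow_diagProj]
    exact isStarProjection_diagProj _
  refine opMajorizes_smul_add_smul ((isStarProjection_ketbra hψ).tensorCompl hproj)
    ((isStarProjection_ketbra hφ).tensorCompl hproj) (trace_tensorCompl_ketbra S hψ)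
    (trace_tensorCompl_ketbra S hφ) (crossLabels d I J) (crossVec S I J ψ φ)
    (crossVec S J I φ ψ) (tensorCompl_ketbra_mul S I J ψ φ)
    (sum_norm_crossVec_sq_le hS I J hψ hφ) ?_ ha hb
  rw [crossLabels_comm, Finset.inter_comm]
  exact sum_norm_crossVec_sq_le hS J I hφ hψ

end Aligned

/-! ### Spin alignment -/

section SpinAlignment

theorem Matrix.IsHermitian.eq_sum_eigenvalues_smul_ketbra {ι : Type*} [Fintype ι] [DecidableEq ι]
    {A : Matrix ι ι ℂ} (hA : A.IsHermitian) :
    A = ∑ i, hA.eigenvalues i • ketbra (hA.eigenvectorBasis i) := by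
  conv_lhs => rw [hA.spectral_theorem]
  ext x y
  rw [Unitary.conjStarAlgAut_apply, Matrix.mul_apply, Matrix.sum_apply]
  refine Finset.sum_congr rfl fun i _ => ?_
  rw [Matrix.mul_diagonal]
  simp only [Matrix.star_apply, Matrix.IsHermitian.eigenvectorUnitary_apply, Function.comp_apply,
    Matrix.smul_apply, ketbra, Matrix.vecMulVec_apply, Pi.star_apply, Complex.real_smul]
  change _ * (hA.eigenvalues i : ℂ) * _ = _
  ring

theorem IsState.exists_eq_sum_smul_ketbra {ι : Type*} [Fintype ι] [DecidableEq ι]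
    {ρ : Matrix ι ι ℂ} (hρ : IsState ρ) :
    ∃ (p : ι → ℝ) (ψ : ι → EuclideanSpace ℂ ι), (∀ i, 0 ≤ p i) ∧ ∑ i, p i = 1 ∧
      (∀ i, ‖ψ i‖ = 1) ∧ ρ = ∑ i, p i • ketbra (ψ i) := by
  have hH := hρ.posSemidef.isHermitian
  refine ⟨hH.eigenvalues, hH.eigenvectorBasis, hρ.posSemidef.eigenvalues_nonneg, ?_,
    hH.eigenvectorBasis.orthonormal.1, hH.eq_sum_eigenvalues_smul_ketbra⟩
  have h := congrArg Complex.re hρ.trace_eq_one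
  rw [hH.trace_eq_sum_eigenvalues, Complex.re_sum] at h
  simpa using h

/-- The unitary matrix whose columns are the vectors of the orthonormal basis `q`. -/
noncomputable def basisMatrix {d : ℕ} (q : OrthonormalBasis (Fin d) ℂ (EuclideanSpace ℂ (Fin d))) :
    Matrix (Fin d) (Fin d) ℂ :=
  (EuclideanSpace.basisFun (Fin d) ℂ).toBasis.toMatrix q

theorem basisMatrix_mem_unitaryGroup {d : ℕ}
    (q : OrthonormalBasis (Fin d) ℂ (EuclideanSpace ℂ (Fin d))) :
    basisMatrix q ∈ Matrix.unitaryGroup (Fin d) ℂ :=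
  (EuclideanSpace.basisFun (Fin d) ℂ).toMatrix_orthonormalBasis_mem_unitary q

theorem ketbra_eq_basisMatrix_conj {d : ℕ}
    (q : OrthonormalBasis (Fin d) ℂ (EuclideanSpace ℂ (Fin d))) (i : Fin d) :
    ketbra (q i) = basisMatrix q * ketbra (EuclideanSpace.single i 1) *
      (basisMatrix q).conjTranspose := by
  rw [mul_ketbra_mul_conjTranspose]
  congr 1
  ext j
  simp [basisMatrix, Module.Basis.toMatrix_apply]

variable {d n : ℕ} [NeZero d]

/-- In the eigenbasis `q`, a state proportional to a projector is a positive multiple of a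
coordinate projector whose range contains the first basis vector. -/
theorem IsState.exists_eq_smul_diagProj {Q : Matrix (Fin d) (Fin d) ℂ} (hQ : IsState Q)
    (hproj : ∃ (c : ℂ) (P : Matrix (Fin d) (Fin d) ℂ), IsStarProjection P ∧ Q = c • P)
    (q : OrthonormalBasis (Fin d) ℂ (EuclideanSpace ℂ (Fin d)))
    {eig : Fin d → ℝ} (heig : Antitone eig) (hspec : Q = ∑ i, eig i • ketbra (q i)) :
    ∃ (r : ℝ) (S : Finset (Fin d)), 0 ≤ r ∧ 0 ∈ S ∧
      Q = basisMatrix q * (r • diagProj S) * (basisMatrix q).conjTranspose := by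
  obtain ⟨c, P, hP, hQP⟩ := hproj
  set U := basisMatrix q
  have hU : U.conjTranspose * U = 1 :=
    Matrix.mem_unitaryGroup_iff'.1 (basisMatrix_mem_unitaryGroup q)
  have hdiag : Q = U * Matrix.diagonal (fun i => (eig i : ℂ)) * U.conjTranspose := by
    have : Matrix.diagonal (fun i => (eig i : ℂ)) =
        ∑ i, eig i • ketbra (EuclideanSpace.single i 1) := by
      ext x y
      simp [Matrix.sum_apply, ketbra_single, diagProj, Matrix.diagonal_apply]
    rw [this, hspec, Finset.mul_sum, Finset.sum_mul]
    refine Finset.sum_congr rfl fun i _ => ?_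
    rw [ketbra_eq_basisMatrix_conj, mul_smul_comm, smul_mul_assoc]
  have hdiag' : Matrix.diagonal (fun i => (eig i : ℂ)) = U.conjTranspose * Q * U := by
    rw [hdiag]
    calc _ = 1 * Matrix.diagonal (fun i => (eig i : ℂ)) * 1 := by simp
      _ = _ := by rw [← hU]; noncomm_ring
  have hQQ : Q * Q = c • Q := by
    rw [hQP, smul_mul_smul_comm, hP.isIdempotentElem.eq, smul_smul]
  have hquad : ∀ i, (eig i : ℂ) * eig i = c * eig i := by
    have h : Matrix.diagonal (fun i => (eig i : ℂ)) * Matrix.diagonal (fun i => (eig i : ℂ)) =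
        c • Matrix.diagonal (fun i => (eig i : ℂ)) := by
      have hU' : U * U.conjTranspose = 1 :=
        Matrix.mem_unitaryGroup_iff.1 (basisMatrix_mem_unitaryGroup q)
      calc _ = U.conjTranspose * Q * (U * U.conjTranspose) * Q * U := by
            rw [hdiag']; noncomm_ring
        _ = U.conjTranspose * (Q * Q) * U := by rw [hU']; noncomm_ring
        _ = _ := by rw [hQQ, hdiag', mul_smul_comm, smul_mul_assoc]
    intro i
    have := congrFun (congrFun h i) i
    simpa using this
  have hsum : ∑ i, eig i = 1 := by
    have h := hQ.trace_eq_one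
    rw [hdiag, Matrix.trace_mul_cycle, hU, one_mul, Matrix.trace_diagonal] at h
    exact_mod_cast h
  have hpos : 0 < eig 0 := by
    by_contra! h0
    have : ∑ i, eig i ≤ 0 := Finset.sum_nonpos fun i _ => (heig (Fin.zero_le i)).trans h0
    linarith
  have hc : c = eig 0 := by
    have h0 : (eig 0 : ℂ) ≠ 0 := by exact_mod_cast hpos.ne'
    exact (mul_right_cancel₀ h0 (hquad 0)).symm
  refine ⟨eig 0, Finset.univ.filter fun i => eig i ≠ 0, hpos.le, by simp [hpos.ne'], ?_⟩
  rw [hdiag]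
  congr 2
  rw [diagProj, ← Matrix.diagonal_smul]
  congr 1
  ext1 i
  by_cases hi : eig i = 0
  · simp [hi]
  · have h0 : (eig i : ℂ) ≠ 0 := by exact_mod_cast hi
    have := mul_right_cancel₀ h0 (hquad i)
    simp [hi, this, hc]

/-- Spin alignment for pure states and two subsets of sites: a unitary change of basis on every
site turns `Q` into a multiple of a coordinate projector and `q₀` into the first basis vector. -/
theorem opMajorizes_tensorCompl_ketbra {Q : Matrix (Fin d) (Fin d) ℂ}
    {q : OrthonormalBasis (Fin d) ℂ (EuclideanSpace ℂ (Fin d))}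
    {r : ℝ} (hr : 0 ≤ r) {S : Finset (Fin d)} (hS : 0 ∈ S)
    (hQ : Q = basisMatrix q * (r • diagProj S) * (basisMatrix q).conjTranspose)
    (I J : Finset (Fin n)) {ψ : EuclideanSpace ℂ (I → Fin d)} {φ : EuclideanSpace ℂ (J → Fin d)}
    (hψ : ‖ψ‖ = 1) (hφ : ‖φ‖ = 1) {a b : ℝ} (ha : 0 ≤ a) (hb : 0 ≤ b) :
    OpMajorizes
      (a • tensorCompl I (tensorPow I (ketbra (q 0))) (tensorPow Iᶜ Q)
        + b • tensorCompl J (tensorPow J (ketbra (q 0))) (tensorPow Jᶜ Q))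
      (a • tensorCompl I (ketbra ψ) (tensorPow Iᶜ Q)
        + b • tensorCompl J (ketbra φ) (tensorPow Jᶜ Q)) := by
  set U := basisMatrix q
  have hU := basisMatrix_mem_unitaryGroup q
  obtain ⟨ψ', hψ', hψU⟩ :=
    exists_ketbra_eq_unitary_conj (piPow_mem_unitaryGroup (κ := I) hU) hψ
  obtain ⟨φ', hφ', hφU⟩ :=
    exists_ketbra_eq_unitary_conj (piPow_mem_unitaryGroup (κ := J) hU) hφ
  have hq : ∀ K : Finset (Fin n), tensorPow K (ketbra (q 0)) =
      tensorPow K U * tensorPow K (ketbra (EuclideanSpace.single 0 1)) *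
        (tensorPow K U).conjTranspose := by
    intro K
    simp only [tensorPow_eq_piPow, conjTranspose_piPow, piPow_mul, ← ketbra_eq_basisMatrix_conj, U]
  have hscale : ∀ (K : Finset (Fin n)) (A : Matrix (K → Fin d) (K → Fin d) ℂ),
      tensorCompl K A (tensorPow Kᶜ (r • diagProj S)) =
        r ^ Fintype.card (Kᶜ : Finset (Fin n)) • tensorCompl K A (tensorPow Kᶜ (diagProj S)) := by
    intro K A
    rw [tensorPow_eq_piPow, piPow_smul, tensorCompl_smul, tensorPow_eq_piPow]
  have hconj : ∀ X Y : Matrix (Fin n → Fin d) (Fin n → Fin d) ℂ,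
      a • (piPow (Fin n) U * X * (piPow (Fin n) U).conjTranspose) +
        b • (piPow (Fin n) U * Y * (piPow (Fin n) U).conjTranspose) =
      piPow (Fin n) U * (a • X + b • Y) * (piPow (Fin n) U).conjTranspose := by
    intro X Y
    rw [mul_add, add_mul, mul_smul_comm, mul_smul_comm, smul_mul_assoc, smul_mul_assoc]
  rw [hψU, hφU, hq, hq, hQ, ← tensorPow_eq_piPow I, ← tensorPow_eq_piPow J,
    ← piPow_conj_tensorCompl, ← piPow_conj_tensorCompl, ← piPow_conj_tensorCompl,
    ← piPow_conj_tensorCompl, hconj, hconj]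
  refine OpMajorizes.unitary_conj (piPow_mem_unitaryGroup hU) ?_
  simp only [hscale, smul_smul, tensorCompl_single_eq_diagProj]
  exact opMajorizes_diagProj hS I J hψ' hφ' (by positivity) (by positivity)

theorem OpMajorizes.sum_smul_add {ι α : Type*} [Fintype ι] [DecidableEq ι] [Fintype α]
    {B Y : Matrix ι ι ℂ} {X : α → Matrix ι ι ℂ} {w : α → ℝ} (hw0 : ∀ u, 0 ≤ w u)
    (hw1 : ∑ u, w u = 1) (h : ∀ u, OpMajorizes B (X u + Y)) :
    OpMajorizes B (∑ u, w u • X u + Y) := by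
  have : ∑ u, w u • X u + Y = ∑ u, w u • (X u + Y) := by
    simp_rw [smul_add]
    rw [Finset.sum_add_distrib, ← Finset.sum_smul, hw1, one_smul]
  rw [this]
  exact OpMajorizes.sum_smul Finset.univ (fun u _ => hw0 u) hw1 fun u _ => h u

/-- Spin alignment for arbitrary states and two subsets of sites, by convexity. -/
theorem opMajorizes_tensorCompl {Q : Matrix (Fin d) (Fin d) ℂ}
    {q : OrthonormalBasis (Fin d) ℂ (EuclideanSpace ℂ (Fin d))}
    {r : ℝ} (hr : 0 ≤ r) {S : Finset (Fin d)} (hS : 0 ∈ S)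
    (hQ : Q = basisMatrix q * (r • diagProj S) * (basisMatrix q).conjTranspose)
    (I J : Finset (Fin n)) {ρ : Matrix (I → Fin d) (I → Fin d) ℂ}
    {σ : Matrix (J → Fin d) (J → Fin d) ℂ}
    (hρ : IsState ρ) (hσ : IsState σ) {a b : ℝ} (ha : 0 ≤ a) (hb : 0 ≤ b) :
    OpMajorizes
      (a • tensorCompl I (tensorPow I (ketbra (q 0))) (tensorPow Iᶜ Q)
        + b • tensorCompl J (tensorPow J (ketbra (q 0))) (tensorPow Jᶜ Q))
      (a • tensorCompl I ρ (tensorPow Iᶜ Q) + b • tensorCompl J σ (tensorPow Jᶜ Q)) := by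
  obtain ⟨p, ψ, hp0, hp1, hψ, rfl⟩ := hρ.exists_eq_sum_smul_ketbra
  obtain ⟨s, φ, hs0, hs1, hφ, rfl⟩ := hσ.exists_eq_sum_smul_ketbra
  simp_rw [sum_smul_tensorCompl, Finset.smul_sum, smul_comm a, smul_comm b]
  refine OpMajorizes.sum_smul_add hp0 hp1 fun u => ?_
  rw [add_comm (a • tensorCompl I (ketbra (ψ u)) _)]
  refine OpMajorizes.sum_smul_add hs0 hs1 fun v => ?_
  rw [add_comm (b • tensorCompl J (ketbra (φ v)) _)]
  exact opMajorizes_tensorCompl_ketbra hr hS hQ I J (hψ u) (hφ v) ha hb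

theorem exists_sum_smul_eq_of_ncard_support_le_two {α : Type*} [Fintype α] [Nonempty α]
    {μ : α → ℝ} (hμ : ∀ i, 0 ≤ μ i) (h2 : (Function.support μ).ncard ≤ 2) :
    ∃ (i j : α) (a b : ℝ), 0 ≤ a ∧ 0 ≤ b ∧
      ∀ {M : Type*} [AddCommGroup M] [Module ℝ M] (X : α → M),
        ∑ k, μ k • X k = a • X i + b • X j := by
  classical
  have hsum : ∀ {M : Type _} [AddCommGroup M] [Module ℝ M] (X : α → M),
      ∑ k, μ k • X k = ∑ k ∈ (Function.support μ).toFinset, μ k • X k := by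
    intro M _ _ X
    refine (Finset.sum_subset (Finset.subset_univ _) fun k _ hk => ?_).symm
    rw [Set.mem_toFinset, Function.notMem_support] at hk
    rw [hk, zero_smul]
  rw [Set.ncard_eq_toFinset_card'] at h2
  interval_cases h : (Function.support μ).toFinset.card
  · obtain ⟨i⟩ := ‹Nonempty α›
    refine ⟨i, i, 0, 0, le_rfl, le_rfl, fun X => ?_⟩
    rw [hsum, Finset.card_eq_zero.1 h]
    simp
  · obtain ⟨i, hi⟩ := Finset.card_eq_one.1 h
    refine ⟨i, i, μ i, 0, hμ i, le_rfl, fun X => ?_⟩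
    rw [hsum, hi]
    simp
  · obtain ⟨i, j, hij, hs⟩ := Finset.card_eq_two.1 h
    refine ⟨i, j, μ i, μ j, hμ i, hμ j, fun X => ?_⟩
    rw [hsum, hs, Finset.sum_pair hij]

end SpinAlignment

theorem mainTheorem4 {d n : ℕ} [NeZero d]
    (Q : Matrix (Fin d) (Fin d) ℂ) (hQ : IsState Q)
    (hproj : ∃ (c : ℂ) (P : Matrix (Fin d) (Fin d) ℂ), IsStarProjection P ∧ Q = c • P)
    (q : OrthonormalBasis (Fin d) ℂ (EuclideanSpace ℂ (Fin d)))
    (eig : Fin d → ℝ) (heig : Antitone eig)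
    (hspec : Q = ∑ i, eig i • ketbra (q i)) :
    (∀ (t : ℝ), t ∈ Set.Icc (0 : ℝ) 1 →
      ∀ (I₁ I₂ : Finset (Fin n))
        (ψ₁ : EuclideanSpace ℂ (I₁ → Fin d)) (ψ₂ : EuclideanSpace ℂ (I₂ → Fin d)),
        ‖ψ₁‖ = 1 → ‖ψ₂‖ = 1 →
        OpMajorizes
          ((1 - t) • tensorCompl I₁ (tensorPow I₁ (ketbra (q 0))) (tensorPow I₁ᶜ Q)
            + t • tensorCompl I₂ (tensorPow I₂ (ketbra (q 0))) (tensorPow I₂ᶜ Q))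
          ((1 - t) • tensorCompl I₁ (ketbra ψ₁) (tensorPow I₁ᶜ Q)
            + t • tensorCompl I₂ (ketbra ψ₂) (tensorPow I₂ᶜ Q))) ∧
    (∀ μ : Finset (Fin n) → ℝ, (∀ I, 0 ≤ μ I) → ∑ I, μ I = 1 →
      (Function.support μ).ncard ≤ 2 →
      ∀ ρ : (I : Finset (Fin n)) → Matrix (I → Fin d) (I → Fin d) ℂ, (∀ I, IsState (ρ I)) →
        OpMajorizes
          (alignmentOperator μ Q (fun I => tensorPow I (ketbra (q 0))))
          (alignmentOperator μ Q ρ)) := by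
  obtain ⟨r, S, hr, hS, hQS⟩ := hQ.exists_eq_smul_diagProj hproj q heig hspec
  refine ⟨fun t ht I₁ I₂ ψ₁ ψ₂ hψ₁ hψ₂ => ?_, fun μ hμ _ hsupp ρ hρ => ?_⟩
  · exact opMajorizes_tensorCompl_ketbra hr hS hQS I₁ I₂ hψ₁ hψ₂ (sub_nonneg.2 ht.2) ht.1
  · obtain ⟨I, J, a, b, ha, hb, hsum⟩ := exists_sum_smul_eq_of_ncard_support_le_two hμ hsupp
    simp only [alignmentOperator]
    rw [hsum, hsum]
    exact opMajorizes_tensorCompl hr hS hQS I J (hρ I) (hρ J) ha hb
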